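/- Let $q\ge 1$, $A\in\mathbb{R}^{m\times n}$, $b\in\mathbb{R}^m$, $P\in\mathbb{R}^{q\times n}$, $Y\in\mathbb{R}^{q\times o}$, $Z\in\mathbb{R}^{q\times p}$, $c\in\mathbb{R}^q$. Put $S=\{x\in\mathbb{R}^n : Ax\ge b\}$, and let $$C=\{Y\lambda : \lambda\in\mathbb{R}^o_+\}=\{y\in\mathbb{R}^q : Z^\top y\ge 0\}$$ be a polyhedral convex cone given in both forms. Write $e^q$ for the last unit vector and $K=\mathbb{R}_+e^q$, and define the lower image $$\mathcal{D}^*=\{(w_1,\dots,w_{q-1},b^\top u)^\top : u\ge 0,\ A^\top u=P^\top w,\ c^\top w=1,\ Y^\top w\ge 0\}-K .$$ For $y,y^*\in\mathbb{R}^q$ let $\omega(y^*)=(y^*_1,\dots,y^*_{q-1},1-\sum_{i<q}c_iy^*_i)^\top$ (which does not depend on $y_q^*$) and $\varphi(y,y^*)=\sum_{i<q}y_iy^*_i+y_q\bigl(1-\sum_{i<q}c_iy^*_i\bigr)-y^*_q$. Consider the following algorithm (simplified dual variant of Benson's algorithm). It works with a finite system of affine inequalities with solution set $\mathcal{O}^*$,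 finite sets $\mathcal{O}^*_{\rm poi}$, $T^*\subseteq\mathbb{R}^q$, and a point $t^*$ whose last coordinate may be $+\infty$. *Initialization.* $\mathcal{O}^*\leftarrow\{y^* : y^\top\omega(y^*)\ge 0 \text{ for every column } y \text{ of } Y\}$; $T^*\leftarrow\emptyset$; $w\leftarrow$ sum of the columns of $Z$; $t^*\leftarrow(c^\top w)^{-1}w$; $t^*_q\leftarrow\infty$. *Loop.* Repeat: set $w\leftarrow\omega(t^*)$ and let $x$ be any optimal solution of the linear program $\min w^\top Px$ s.t. $Ax\ge b$. If $t^*_q-w^\top Px>0$, add the inequality $\varphi(Px,y^*)\ge 0$ to the system describing $\mathcal{O}^*$ and let $\mathcal{O}^*_{\rm poi}$ be the set of vertices of the new $\mathcal{O}^*$; otherwise set $T^*\leftarrow T^*\cup\{t^*\}$. Then, if $\mathcal{O}^*_{\rm poi}\setminus T^*\ne\emptyset$, choose any $t^*\in\mathcal{O}^*_{\rm poi}\setminus T^*$ and continue; otherwise stop and output $\mathcal{O}^*_{\rm poi}$ and $\mathcal{O}^*$. **Theorem.** Assume $S\ne\emptyset$, $C\cap(-C)=\{0\}$ ($C$ is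 pointed), $c\in\operatorname{int}C$ (so $C$ is solid), $c_q=1$, and that the recession cone of $P[S]=\{Px : x\in S\}$ is contained in $C$. Then, for every choice of optimal solutions $x$ and of vertices $t^*$, the algorithm is well defined (at the initialization $c^\top w\neq 0$; every linear program that it meets has an optimal solution; every set of vertices that it computes is finite), it stops after finitely many iterations, and at termination the system describing $\mathcal{O}^*$ is an H-representation of $\mathcal{D}^*$ and $(\mathcal{O}^*_{\rm poi},\{-e^q\})$ is a V-representation of $\mathcal{D}^*$; that is, $\mathcal{O}^*=\mathcal{D}^*$, the set $\mathcal{O}^*_{\rm poi}$ is finite and nonempty, and $\mathcal{D}^*=\operatorname{conv}\mathcal{O}^*_{\rm poi}+\operatorname{cone}\{-e^q\}$. -/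

import Mathlib

open scoped Matrix Pointwise

noncomputable section

namespace DualBenson

/-- The space `ℝ^q` with `q = k + 1 ≥ 1`; the `q`-th coordinate is the one at `Fin.last k`. -/
abbrev Vec (k : ℕ) : Type := Fin (k + 1) → ℝ

/-- Append a `q`-th coordinate to a vector of `q - 1 = k` coordinates. -/
def append {k : ℕ} (s : Fin k → ℝ) (a : ℝ) : Vec k := Fin.snoc (α := fun _ => ℝ) s a

/-- The first `q - 1` coordinates. -/
def head {k : ℕ} (y : Vec k) : Fin k → ℝ := fun i => y i.castSucc

/-! ### Polyhedra and their representations -/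

/-- An affine inequality `β ≤ aᵀ y`, stored as the pair `(a, β)`. -/
abbrev AffIneq (k : ℕ) : Type := Vec k × ℝ

/-- The solution set of a finite system of affine inequalities. -/
def solutionSet {k : ℕ} (L : List (AffIneq k)) : Set (Vec k) :=
  {y | ∀ h ∈ L, h.2 ≤ h.1 ⬝ᵥ y}

/-- The finite system `L` is an H-representation of `Q`. -/
def IsHRep {k : ℕ} (L : List (AffIneq k)) (Q : Set (Vec k)) : Prop :=
  Q = solutionSet L

/-- The pair `(pts, dirs)` is a V-representation of `Q`: `Q = conv pts + cone dirs`, where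
`pts` and `dirs` are finite, `pts` is nonempty and `cone ∅ = {0}`. -/
def IsVRep {k : ℕ} (pts dirs : Finset (Vec k)) (Q : Set (Vec k)) : Prop :=
  pts.Nonempty ∧
    Q = convexHull ℝ (pts : Set (Vec k)) +
      (PointedCone.hull ℝ (dirs : Set (Vec k)) : Set (Vec k))

/-- The recession cone of a (convex) set. -/
def recc {k : ℕ} (Q : Set (Vec k)) : Set (Vec k) :=
  {d | ∀ y ∈ Q, ∀ r : ℝ, 0 ≤ r → y + r • d ∈ Q}

/-! ### The vector linear program and its geometric dual -/

/-- The data `A, b, P, Z, Y, c`. -/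
structure Data (k m n o p : ℕ) where
  /-- The constraint matrix. -/
  A : Matrix (Fin m) (Fin n) ℝ
  /-- The right-hand side. -/
  b : Fin m → ℝ
  /-- The objective matrix. -/
  P : Matrix (Fin (k + 1)) (Fin n) ℝ
  /-- The columns of `Z` describe the ordering cone by inequalities. -/
  Z : Matrix (Fin (k + 1)) (Fin p) ℝ
  /-- The columns of `Y` generate the ordering cone. -/
  Y : Matrix (Fin (k + 1)) (Fin o) ℝ
  /-- The direction that normalizes the weights. -/
  c : Vec k

variable {k m n o p : ℕ}

/-- The feasible set `S = {x | A x ≥ b}`. -/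
def Data.S (I : Data k m n o p) : Set (Fin n → ℝ) := {x | I.b ≤ I.A *ᵥ x}

/-- The image `P[S]`. -/
def Data.imageS (I : Data k m n o p) : Set (Vec k) := (fun x => I.P *ᵥ x) '' I.S

/-- `x` is an optimal solution of the weighted sum scalarization
`min wᵀ P x` subject to `A x ≥ b`. -/
def Data.IsSolution (I : Data k m n o p) (w : Vec k) (x : Fin n → ℝ) : Prop :=
  x ∈ I.S ∧ ∀ x' ∈ I.S, w ⬝ᵥ (I.P *ᵥ x) ≤ w ⬝ᵥ (I.P *ᵥ x')

/-- The feasible set of the geometric dual problem. -/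
def Data.dualFeasible (I : Data k m n o p) : Set ((Fin m → ℝ) × Vec k) :=
  {z | 0 ≤ z.1 ∧ I.Aᵀ *ᵥ z.1 = I.Pᵀ *ᵥ z.2 ∧ I.c ⬝ᵥ z.2 = 1 ∧ 0 ≤ I.Yᵀ *ᵥ z.2}

/-- The dual objective `D*(u, w) = (w_1, …, w_{q-1}, bᵀ u)`. -/
def Data.dualObjective (I : Data k m n o p) (z : (Fin m → ℝ) × Vec k) : Vec k :=
  append (head z.2) (I.b ⬝ᵥ z.1)

/-- The unit vector `e^q`. -/
def eLast (k : ℕ) : Vec k := append 0 1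

/-- The dual ordering cone `K = ℝ₊ · e^q`. -/
def coneK (k : ℕ) : Set (Vec k) := {y | ∃ r : ℝ, 0 ≤ r ∧ y = r • eLast k}

/-- The lower image `𝒟* = D*[T] - K`. -/
def Data.lowerImage (I : Data k m n o p) : Set (Vec k) :=
  I.dualObjective '' I.dualFeasible - coneK k

/-- `ω(y*) = (y*_1, …, y*_{q-1}, 1 - ∑_{i<q} c_i y*_i)`; it depends on the first `q - 1`
coordinates `s` of `y*` only. -/
def omega (c : Vec k) (s : Fin k → ℝ) : Vec k :=
  append s (1 - ∑ i, c i.castSucc * s i)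

/-- The coupling function
`φ(y, y*) = ∑_{i<q} y_i y*_i + y_q (1 - ∑_{i<q} c_i y*_i) - y*_q`. -/
def phi (c y ys : Vec k) : ℝ :=
  (∑ i : Fin k, y i.castSucc * ys i.castSucc)
    + y (Fin.last k) * (1 - ∑ i : Fin k, c i.castSucc * ys i.castSucc) - ys (Fin.last k)

/-- The inequality `yᵀ ω(y*) ≥ 0` in the unknown `y*`, in coefficient form. -/
def omegaIneq (c y : Vec k) : AffIneq k :=
  (append (fun i => y i.castSucc - y (Fin.last k) * c i.castSucc) 0, -y (Fin.last k))

/-- The inequality `φ(y, y*) ≥ 0` in the unknown `y*`, in coefficient form. -/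
def phiIneq (c y : Vec k) : AffIneq k :=
  (append (fun i => y i.castSucc - y (Fin.last k) * c i.castSucc) (-1), -y (Fin.last k))

theorem omegaIneq_iff (c y ys : Vec k) :
    (omegaIneq c y).2 ≤ (omegaIneq c y).1 ⬝ᵥ ys ↔ 0 ≤ y ⬝ᵥ omega c (head ys) := by
  simp only [omegaIneq, omega, append, head, dotProduct, Fin.sum_univ_castSucc, Fin.snoc_castSucc,
    Fin.snoc_last, sub_mul, Finset.sum_sub_distrib, mul_sub, Finset.mul_sum, mul_assoc]
  constructor <;> intro h <;> linarith

theorem phiIneq_iff (c y ys : Vec k) :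
    (phiIneq c y).2 ≤ (phiIneq c y).1 ⬝ᵥ ys ↔ 0 ≤ phi c y ys := by
  simp only [phiIneq, phi, append, dotProduct, Fin.sum_univ_castSucc, Fin.snoc_castSucc,
    Fin.snoc_last, sub_mul, Finset.sum_sub_distrib, mul_sub, Finset.mul_sum, mul_assoc]
  constructor <;> intro h <;> linarith

/-! ### The algorithm

One `Step` is one pass through the body of the loop. The solver may return any optimal solution
and the choice of the next vertex is arbitrary, so `Step` is a relation. -/

/-- A point `t*` whose last coordinate may be `∞`. -/
abbrev ExtPoint (k : ℕ) : Type := (Fin k → ℝ) × WithTop ℝ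

/-- An ordinary point as a point of the extended kind. -/
def toExt (y : Vec k) : ExtPoint k := (head y, (y (Fin.last k) : WithTop ℝ))

/-- The program variables: the inequalities describing `𝒪*`, the list `𝒪*_poi` of its vertices,
the set `T*` and the point `t*`. -/
structure Vars (k : ℕ) where
  /-- The inequalities describing the outer approximation `𝒪*`. -/
  ineqs : List (AffIneq k)
  /-- The computed vertices of `𝒪*`. -/
  poi : Finset (Vec k)
  /-- The confirmed vertices `T*`. -/
  confirmed : Finset (Vec k)
  /-- The current point `t*`. -/
  t : ExtPoint k

/-- Either the loop is about to be executed once more, or it has been left with the output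
`𝒪*` (a system of inequalities) and `𝒪*_poi`. -/
inductive State (k : ℕ) where
  | running (v : Vars k)
  | halted (ineqs : List (AffIneq k)) (poi : Finset (Vec k))

/-- The sum of the columns of `Z`. -/
def Data.sumZ (I : Data k m n o p) : Vec k := fun i => ∑ j, I.Z i j

/-- The state before the loop: `𝒪* = {y* | yᵀ ω(y*) ≥ 0 for all columns y of Y}`, `T* = ∅`,
and `t* = (cᵀ w)⁻¹ w` for the sum `w` of the columns of `Z`, with `t*_q` replaced by `∞`.
The vertex set has not been computed yet. -/
def Data.init (I : Data k m n o p) : State k :=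
  .running
    { ineqs := List.ofFn fun j : Fin o => omegaIneq I.c fun i => I.Y i j
      poi := ∅
      confirmed := ∅
      t := (head ((I.c ⬝ᵥ I.sumZ)⁻¹ • I.sumZ), ⊤) }

/-- The `if` statement in the first half of the loop body, given the solver's answer `x` for the
weight `w = ω(t*)`: it relates `(𝒪*, 𝒪*_poi, T*)` before and after. -/
inductive Data.Update (I : Data k m n o p) (v : Vars k) (x : Fin n → ℝ) :
    List (AffIneq k) → Finset (Vec k) → Finset (Vec k) → Prop
  /-- `t*_q > wᵀ P x`: cut with `φ(P x, ·) ≥ 0` and compute the vertices anew. -/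
  | cut (poi' : Finset (Vec k))
      (htest : ((omega I.c v.t.1 ⬝ᵥ (I.P *ᵥ x) : ℝ) : WithTop ℝ) < v.t.2)
      (hpoi : (poi' : Set (Vec k)) =
        (solutionSet (phiIneq I.c (I.P *ᵥ x) :: v.ineqs)).extremePoints ℝ) :
      I.Update v x (phiIneq I.c (I.P *ᵥ x) :: v.ineqs) poi' v.confirmed
  /-- Otherwise `t*` is put into `T*`. -/
  | confirm (y : Vec k) (hy : v.t = toExt y)
      (htest : ¬ ((omega I.c v.t.1 ⬝ᵥ (I.P *ᵥ x) : ℝ) : WithTop ℝ) < v.t.2) :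
      I.Update v x v.ineqs v.poi (insert y v.confirmed)

/-- One pass through the loop body. -/
inductive Data.Step (I : Data k m n o p) : State k → State k → Prop
  /-- Some vertex is not in `T*`: choose one and go on. -/
  | next (v : Vars k) (x : Fin n → ℝ) (hx : I.IsSolution (omega I.c v.t.1) x)
      (L : List (AffIneq k)) (poi T : Finset (Vec k)) (hu : I.Update v x L poi T)
      (t : Vec k) (ht : t ∈ poi \ T) :
      I.Step (.running v) (.running ⟨L, poi, T, toExt t⟩)
  /-- All vertices are in `T*`: leave the loop. -/
  | break (v : Vars k) (x : Fin n → ℝ) (hx : I.IsSolution (omega I.c v.t.1) x)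
      (L : List (AffIneq k)) (poi T : Finset (Vec k)) (hu : I.Update v x L poi T)
      (hT : poi \ T = ∅) :
      I.Step (.running v) (.halted L poi)

/-- The states that occur in the executions of the algorithm. -/
def Data.Reachable (I : Data k m n o p) (s : State k) : Prop :=
  Relation.ReflTransGen I.Step I.init s

end DualBenson

end

/-! By linear programming duality, the lower image is cut out by inequalities
(`Data.Regular.lowerImage_eq`): a point belongs to it iff its weight is nonnegative on `C` and its
last coordinate is at most the optimal value of the program with that weight. So every cut is valid,
the outer approximation always contains the lower image, and the solver's test at a vertex decides
whether that vertex lies in the lower image. The programs are solvable because the weights are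
nonnegative on `C`, hence on the recession directions of `P[S]` (`Data.Regular.exists_isSolution`).

Correctness: after one cut, `c ∈ int C` leaves only the recession directions along `-e^q`
(`Data.IsCutSystem.eq_smul_neg_eLast`), so the outer approximation is the convex hull of its
vertices minus `K`. If all vertices lie in the lower image, so does the whole approximation
(`Data.IsCutSystem.representations`).

Termination: the solver may return infinitely many different optimal points, so cuts are counted by
active sets. A feasible point with the same active constraints as an optimal one has no larger value
(`Data.IsSolution.le_of_active_eq`); hence a new cut always uses a new active set. There are
finitely many of these, and each pass without a cut confirms a new vertex
(`Data.Inv.stateMeasure_lt`). -/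

namespace DualBenson

/-! ### Farkas' lemma, attainment of minima, and the structure of polyhedra -/

section Polyhedra

variable {ι V : Type*} [AddCommGroup V] [Module ℝ V]

/-- **Farkas' lemma** for linear functionals on a real vector space. -/
theorem farkas (s : Finset ι) (a : ι → V →ₗ[ℝ] ℝ) (f : V →ₗ[ℝ] ℝ)
    (h : ∀ x, (∀ i ∈ s, 0 ≤ a i x) → 0 ≤ f x) :
    ∃ u : ι → ℝ, 0 ≤ u ∧ ∀ x, f x = ∑ i ∈ s, u i * a i x := by
  classical
  induction s using Finset.induction_on generalizing a f with
  | empty =>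
    refine ⟨0, le_rfl, fun x => ?_⟩
    have h1 := h x (by simp)
    have h2 := h (-x) (by simp)
    rw [map_neg] at h2
    rw [Finset.sum_empty]
    linarith
  | insert j s hj ih =>
    by_cases hs : ∀ x, (∀ i ∈ s, 0 ≤ a i x) → 0 ≤ f x
    · obtain ⟨u, hu, huf⟩ := ih a f hs
      refine ⟨Function.update u j 0, ?_, fun x => ?_⟩
      · intro i
        by_cases hi : i = j
        · subst hi; simp
        · simpa [hi] using hu i
      · rw [Finset.sum_insert hj, huf x, Function.update_self, zero_mul, zero_add]
        refine Finset.sum_congr rfl fun i hi => ?_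
        rw [Function.update_of_ne (by rintro rfl; exact hj hi)]
    · push Not at hs
      obtain ⟨x₁, hx₁, hfx₁⟩ := hs
      have hjx₁ : a j x₁ < 0 := by
        by_contra hcon
        refine absurd (h x₁ fun i hi => ?_) (not_le.mpr hfx₁)
        rcases Finset.mem_insert.mp hi with rfl | hi
        · exact not_lt.mp hcon
        · exact hx₁ i hi
      obtain ⟨x₀, hx₀, hfx₀, hjx₀⟩ : ∃ x₀, (∀ i ∈ s, 0 ≤ a i x₀) ∧ f x₀ < 0 ∧ a j x₀ = -1 := by
        have hpos : 0 < (-a j x₁)⁻¹ := by simpa using hjx₁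
        refine ⟨(-a j x₁)⁻¹ • x₁, fun i hi => ?_, ?_, ?_⟩
        · rw [map_smul, smul_eq_mul]
          exact mul_nonneg hpos.le (hx₁ i hi)
        · rw [map_smul, smul_eq_mul]
          exact mul_neg_of_pos_of_neg hpos hfx₁
        · rw [map_smul, smul_eq_mul, inv_neg, neg_mul, inv_mul_cancel₀ hjx₁.ne]
      -- Projection along `x₀` onto the kernel of `a j`. Constraint `j` is free on its range, so the
      -- induction hypothesis applies to the composites with `g`.
      let g : V →ₗ[ℝ] V := LinearMap.id + (a j).smulRight x₀
      have hg : ∀ x, g x = x + a j x • x₀ := fun x => rfl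
      obtain ⟨u, hu, huf⟩ := ih (fun i => a i ∘ₗ g) (f ∘ₗ g) fun x hx => by
        refine h (g x) fun i hi => ?_
        rcases Finset.mem_insert.mp hi with rfl | hi
        · simp [hg, hjx₀]
        · exact hx i hi
      -- The multiplier of `j` is read off by expanding `f ∘ g = ∑ u i • (a i ∘ g)`; it is
      -- nonnegative because `f x₀ < 0`.
      refine ⟨Function.update u j (∑ i ∈ s, u i * a i x₀ - f x₀), ?_, fun x => ?_⟩
      · intro i
        by_cases hi : i = j
        · subst hi
          have := Finset.sum_nonneg fun i hi => mul_nonneg (hu i) (hx₀ i hi)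
          simp only [Pi.zero_apply, Function.update_self]
          linarith
        · simpa [hi] using hu i
      · have hx := huf x
        simp only [LinearMap.comp_apply, hg, map_add, map_smul, smul_eq_mul, mul_add,
          Finset.sum_add_distrib] at hx
        have hswap : ∑ i ∈ s, u i * (a j x * a i x₀) = a j x * ∑ i ∈ s, u i * a i x₀ := by
          rw [Finset.mul_sum]
          exact Finset.sum_congr rfl fun i _ => by ring
        have hrest : ∑ i ∈ s, Function.update u j (∑ i ∈ s, u i * a i x₀ - f x₀) i * a i x
            = ∑ i ∈ s, u i * a i x := by
          refine Finset.sum_congr rfl fun i hi => ?_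
          rw [Function.update_of_ne (by rintro rfl; exact hj hi)]
        rw [Finset.sum_insert hj, hrest, Function.update_self]
        rw [hswap] at hx
        linarith

/-- The solution set of the system `β i ≤ a i y`. -/
def polyhedron (a : ι → V →ₗ[ℝ] ℝ) (β : ι → ℝ) : Set V := {y | ∀ i, β i ≤ a i y}

/-- If `y` lies strictly between `x₁` and `x₂` in the polyhedron, its active constraints are also
active at `x₁`, so `x₁ - y` is annihilated by them. -/
theorem exists_direction_of_notMem_extremePoints {a : ι → V →ₗ[ℝ] ℝ} {β : ι → ℝ} {y : V}
    (hy : y ∈ polyhedron a β) (hne : y ∉ (polyhedron a β).extremePoints ℝ) :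
    ∃ d, d ≠ 0 ∧ ∀ i, a i y = β i → a i d = 0 := by
  by_contra! hcon
  refine hne ⟨hy, fun x₁ h₁ x₂ h₂ hseg => ?_⟩
  by_contra hx
  obtain ⟨i, hi, hne⟩ := hcon (x₁ - y) (sub_ne_zero.mpr hx)
  obtain ⟨s, t, hs, ht, hst, rfl⟩ := hseg
  apply hne
  have e : a i (s • x₁ + t • x₂) = s * a i x₁ + t * a i x₂ := by simp
  have e1 := h₁ i
  have e2 := mul_le_mul_of_nonneg_left (h₂ i) ht.le
  have e3 : s * (a i x₁ - β i) ≤ 0 := by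
    have : s * β i + t * β i = β i := by rw [← add_mul, hst, one_mul]
    linarith
  rw [map_sub, hi]
  nlinarith

variable [Fintype ι]

/-- **Farkas' lemma**, affine version. -/
theorem farkas_affine (a : ι → V →ₗ[ℝ] ℝ) (β : ι → ℝ) (f : V →ₗ[ℝ] ℝ) (τ : ℝ)
    (hne : (polyhedron a β).Nonempty) (h : ∀ x ∈ polyhedron a β, τ ≤ f x) :
    ∃ u : ι → ℝ, 0 ≤ u ∧ (∀ x, f x = ∑ i, u i * a i x) ∧ τ ≤ ∑ i, u i * β i := by
  obtain ⟨x₀, hx₀⟩ := hne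
  -- Homogenization: an extra coordinate `t` replaces the constants, and the index `none` carries `t
  -- ≥ 0`.
  have key := farkas (Finset.univ : Finset (Option ι))
    (fun i => i.elim (LinearMap.snd ℝ V ℝ)
      fun i => a i ∘ₗ LinearMap.fst ℝ V ℝ - β i • LinearMap.snd ℝ V ℝ)
    (f ∘ₗ LinearMap.fst ℝ V ℝ - τ • LinearMap.snd ℝ V ℝ) ?_
  · obtain ⟨u, hu, huf⟩ := key
    refine ⟨fun i => u (some i), fun i => hu (some i), fun x => ?_, ?_⟩
    · simpa [Fintype.sum_option] using huf (x, 0)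
    · have h1 := huf (0, 1)
      have h2 := hu none
      simp [Fintype.sum_option] at h1 h2
      linarith
  · rintro ⟨x, t⟩ hx
    have ht : 0 ≤ t := by simpa using hx none (Finset.mem_univ _)
    have hx' : ∀ i, β i * t ≤ a i x := fun i => by
      simpa using hx (some i) (Finset.mem_univ _)
    simp only [LinearMap.sub_apply, LinearMap.comp_apply, LinearMap.fst_apply,
      LinearMap.smul_apply, LinearMap.snd_apply, smul_eq_mul, sub_nonneg]
    rcases ht.eq_or_lt with rfl | ht
    · by_contra hcon
      rw [mul_zero, not_le] at hcon
      -- For `t = 0` the vector `x` is a recession direction; this step length from `x₀` would bring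
      -- `f` down to `τ - 1`.
      have hr : 0 ≤ (f x₀ - τ + 1) / -f x :=
        div_nonneg (by linarith [h x₀ hx₀]) (by linarith)
      have := h (x₀ + ((f x₀ - τ + 1) / -f x) • x) fun i => by
        have h1 := hx₀ i
        have h2 := mul_nonneg hr (by simpa using hx' i : 0 ≤ a i x)
        rw [map_add, map_smul, smul_eq_mul]
        linarith
      rw [map_add, map_smul, smul_eq_mul] at this
      have h3 : (f x₀ - τ + 1) / -f x * f x = -(f x₀ - τ + 1) := by
        field_simp [hcon.ne]
      linarith
    · have := h (t⁻¹ • x) fun i => by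
        rw [map_smul, smul_eq_mul, ← div_eq_inv_mul, le_div_iff₀ ht]
        exact hx' i
      rwa [map_smul, smul_eq_mul, ← div_eq_inv_mul, le_div_iff₀ ht] at this

/-- An infeasible system of linear inequalities has an infeasibility certificate. -/
theorem exists_certificate_of_infeasible (a : ι → V →ₗ[ℝ] ℝ) (β : ι → ℝ)
    (h : ¬ (polyhedron a β).Nonempty) :
    ∃ u : ι → ℝ, 0 ≤ u ∧ (∀ x, ∑ i, u i * a i x = 0) ∧ 0 < ∑ i, u i * β i := by
  obtain ⟨u, hu, huf⟩ := farkas (Finset.univ : Finset ι)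
    (fun i => a i ∘ₗ LinearMap.fst ℝ V ℝ - β i • LinearMap.snd ℝ V ℝ)
    (-LinearMap.snd ℝ V ℝ) (by
      rintro ⟨x, t⟩ hx
      simp only [LinearMap.neg_apply, LinearMap.snd_apply, neg_nonneg]
      by_contra! ht
      refine h ⟨t⁻¹ • x, fun i => ?_⟩
      rw [map_smul, smul_eq_mul, ← div_eq_inv_mul, le_div_iff₀ ht]
      simpa using hx i (Finset.mem_univ _))
  refine ⟨u, hu, fun x => ?_, ?_⟩
  · simpa using (huf (x, 0)).symm
  · have h1 := huf (0, 1)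
    simp at h1
    linarith

/-- A linear functional that is bounded below on a nonempty polyhedron attains its minimum. -/
theorem exists_isMinOn_of_bounded (a : ι → V →ₗ[ℝ] ℝ) (β : ι → ℝ) (f : V →ₗ[ℝ] ℝ) (τ : ℝ)
    (hne : (polyhedron a β).Nonempty) (h : ∀ x ∈ polyhedron a β, τ ≤ f x) :
    ∃ x ∈ polyhedron a β, ∀ x' ∈ polyhedron a β, f x ≤ f x' := by
  set τ₀ := sInf (f '' polyhedron a β) with hτ₀
  have hle : ∀ x ∈ polyhedron a β, τ₀ ≤ f x := fun x hx =>
    csInf_le ⟨τ, by rintro _ ⟨x, hx, rfl⟩; exact h x hx⟩ ⟨x, hx, rfl⟩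
  by_contra hcon
  push Not at hcon
  -- If the infimum `τ₀` is not attained, adding `f ≤ τ₀` is infeasible. A certificate with `u none
  -- = 0` contradicts `hne`; one with `u none > 0` gives a lower bound for `f` above `τ₀`.
  obtain ⟨u, hu, hu0, hupos⟩ := exists_certificate_of_infeasible
    (fun i : Option ι => i.elim (-f) a) (fun i => i.elim (-τ₀) β) (by
      rintro ⟨x, hx⟩
      have hxS : x ∈ polyhedron a β := fun i => hx (some i)
      have hxτ : f x ≤ τ₀ := by simpa using hx none
      obtain ⟨x', hx', hlt⟩ := hcon x hxS
      linarith [hle x' hx'])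
  simp only [Fintype.sum_option, Option.elim_none, Option.elim_some, LinearMap.neg_apply]
    at hu0 hupos
  have hsum : ∀ x ∈ polyhedron a β, ∑ i, u (some i) * β i ≤ u none * f x := fun x hx => by
    have h1 : ∑ i, u (some i) * β i ≤ ∑ i, u (some i) * a i x :=
      Finset.sum_le_sum fun i _ => mul_le_mul_of_nonneg_left (hx i) (hu (some i))
    linarith [hu0 x]
  obtain ⟨x₀, hx₀⟩ := hne
  rcases (hu none).eq_or_lt with h0 | hpos
  · have := hsum x₀ hx₀
    simp only [Pi.zero_apply] at h0
    rw [← h0] at this hupos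
    linarith
  · simp only [Pi.zero_apply] at hpos
    have hlow : (∑ i, u (some i) * β i) / u none ≤ τ₀ := by
      refine le_csInf ⟨f x₀, x₀, hx₀, rfl⟩ ?_
      rintro _ ⟨x, hx, rfl⟩
      rw [div_le_iff₀' hpos]
      exact hsum x hx
    rw [div_le_iff₀' hpos] at hlow
    linarith

/-- Inactive constraints have slack and survive a small step, while active ones do not decrease
along `d`. Used both for extreme points and for comparing active sets in the termination proof. -/
theorem eventually_add_smul_mem_polyhedron {a : ι → V →ₗ[ℝ] ℝ} {β : ι → ℝ} {y d : V}
    (hy : y ∈ polyhedron a β) (hd : ∀ i, a i y = β i → 0 ≤ a i d) :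
    ∀ᶠ ε : ℝ in nhdsWithin 0 (Set.Ioi 0), y + ε • d ∈ polyhedron a β := by
  simp only [polyhedron, Set.mem_ofPred_eq, Filter.eventually_all, map_add, map_smul, smul_eq_mul]
  intro i
  rcases (hy i).eq_or_lt with h | h
  · filter_upwards [self_mem_nhdsWithin] with ε hε
    have := mul_nonneg (le_of_lt hε) (hd i h.symm)
    linarith
  · have hcont : Filter.Tendsto (fun ε : ℝ => a i y + ε * a i d) (nhds 0) (nhds (a i y)) := by
      have : Continuous fun ε : ℝ => a i y + ε * a i d := by fun_prop
      simpa using this.tendsto 0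
    filter_upwards [nhdsWithin_le_nhds (hcont.eventually (lt_mem_nhds h))] with ε hε
    exact hε.le

theorem exists_add_sub_mem_polyhedron {a : ι → V →ₗ[ℝ] ℝ} {β : ι → ℝ} {y d : V}
    (hy : y ∈ polyhedron a β) (hd : ∀ i, a i y = β i → a i d = 0) :
    ∃ ε : ℝ, 0 < ε ∧ y + ε • d ∈ polyhedron a β ∧ y + ε • -d ∈ polyhedron a β := by
  have h1 := eventually_add_smul_mem_polyhedron hy fun i hi => (hd i hi).ge
  have h2 := eventually_add_smul_mem_polyhedron (d := -d) hy fun i hi => by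
    rw [map_neg, hd i hi, neg_zero]
  obtain ⟨ε, ⟨h1, h2⟩, hε⟩ := ((h1.and h2).and self_mem_nhdsWithin).exists
  exact ⟨ε, hε, h1, h2⟩

/-- A polyhedron has finitely many extreme points: each is determined by its active constraints. -/
theorem extremePoints_polyhedron_finite (a : ι → V →ₗ[ℝ] ℝ) (β : ι → ℝ) :
    ((polyhedron a β).extremePoints ℝ).Finite := by
  refine Set.Finite.of_injOn (f := fun y => {i | a i y = β i}) (t := Set.univ)
    (fun _ _ => Set.mem_univ _) (fun y hy z hz hyz => ?_) Set.finite_univ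
  have hact : ∀ i, a i y = β i → a i (z - y) = 0 := fun i hi => by
    have hz : i ∈ {i | a i z = β i} := by
      have h : {i | a i y = β i} = {i | a i z = β i} := hyz
      rw [← h]; exact hi
    rw [map_sub, hi, show a i z = β i from hz, sub_self]
  obtain ⟨ε, hε, h1, h2⟩ := exists_add_sub_mem_polyhedron hy.1 hact
  have := hy.2 h1 h2 ⟨1 / 2, 1 / 2, by norm_num, by norm_num, by norm_num, by module⟩
  have h3 : ε • (z - y) = 0 := by simpa using this
  rcases smul_eq_zero.mp h3 with h | h
  · exact absurd h hε.ne'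
  · exact (sub_eq_zero.mp h).symm

/-- Moving along a direction that is not recessive, one meets a new constraint. -/
theorem exists_boundary_point {a : ι → V →ₗ[ℝ] ℝ} {β : ι → ℝ} {y d : V}
    (hy : y ∈ polyhedron a β) (hd : ∀ i, a i y = β i → a i d = 0) (hneg : ∃ j, a j d < 0) :
    ∃ r : ℝ, 0 < r ∧ y + r • d ∈ polyhedron a β ∧
      Set.ncard {i | a i (y + r • d) ≠ β i} < Set.ncard {i | a i y ≠ β i} := by
  classical
  obtain ⟨j₀, hj₀⟩ := hneg
  -- Ratio test: `j` is a constraint that is met first. It becomes active, and the old active ones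
  -- stay so because they vanish on `d`.
  obtain ⟨j, hj, hmin⟩ := Finset.exists_min_image (Finset.univ.filter fun j => a j d < 0)
    (fun j => (a j y - β j) / -a j d) ⟨j₀, by simpa using hj₀⟩
  have hj : a j d < 0 := by simpa using hj
  have hyj : β j < a j y := by
    refine lt_of_le_of_ne (hy j) fun h => ?_
    rw [hd j h.symm] at hj
    exact lt_irrefl _ hj
  have hr : 0 < (a j y - β j) / -a j d := div_pos (by linarith) (by linarith)
  have hzero : a j y + (a j y - β j) / -a j d * a j d = β j := by
    field_simp [hj.ne]
    ring
  set r := (a j y - β j) / -a j d with hrdef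
  refine ⟨r, hr, fun i => ?_, ?_⟩
  · rw [map_add, map_smul, smul_eq_mul]
    rcases lt_or_ge (a i d) 0 with hi | hi
    · have := hmin i (by simpa using hi)
      rw [le_div_iff₀ (by linarith)] at this
      linarith
    · have := mul_nonneg hr.le hi
      linarith [hy i]
  · refine Set.ncard_lt_ncard ⟨fun i hi hiy => hi ?_, fun hsub => ?_⟩ (Set.toFinite _)
    · rw [map_add, map_smul, hd i hiy, hiy, smul_zero, add_zero]
    · refine hsub (show a j y ≠ β j from hyj.ne') ?_
      rw [map_add, map_smul, smul_eq_mul, hzero]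

/-- A polyhedron without lines is the convex hull of its extreme points plus its
recession cone. -/
theorem exists_add_of_mem_polyhedron {a : ι → V →ₗ[ℝ] ℝ} {β : ι → ℝ}
    (hline : ∀ d, (∀ i, a i d = 0) → d = 0) {y : V} (hy : y ∈ polyhedron a β) :
    y ∈ convexHull ℝ ((polyhedron a β).extremePoints ℝ) + {d | ∀ i, 0 ≤ a i d} := by
  have hR : Convex ℝ {d | ∀ i, 0 ≤ a i d} := fun x hx z hz s t hs ht _ i => by
    rw [map_add, map_smul, map_smul]
    exact add_nonneg (mul_nonneg hs (hx i)) (mul_nonneg ht (hz i))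
  have hconv := (convex_convexHull ℝ ((polyhedron a β).extremePoints ℝ)).add hR
  -- Induction on the number of inactive constraints, moving along a direction `d` that keeps the
  -- active ones. If both `d` and `-d` leave the polyhedron, `y` is between two boundary points; if
  -- only one does, `y` is a boundary point plus a recession direction; if neither does, `d` spans a
  -- line.
  induction hN : Set.ncard {i | a i y ≠ β i} using Nat.strong_induction_on generalizing y with
  | _ N ih =>
  subst hN
  by_cases hext : y ∈ (polyhedron a β).extremePoints ℝ
  · exact ⟨y, subset_convexHull ℝ _ hext, 0, by simp, add_zero y⟩
  obtain ⟨d, hd0, hd⟩ := exists_direction_of_notMem_extremePoints hy hext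
  have half : ∀ d : V, (∀ i, a i y = β i → a i d = 0) → (∃ j, a j d < 0) →
      (∀ i, 0 ≤ a i (-d)) →
      y ∈ convexHull ℝ ((polyhedron a β).extremePoints ℝ) + {d | ∀ i, 0 ≤ a i d} := by
    intro d hd hneg hrec
    obtain ⟨r, hr, hmem, hlt⟩ := exists_boundary_point hy hd hneg
    obtain ⟨z, hz, e, he, hze⟩ := ih _ hlt hmem rfl
    refine ⟨z, hz, e + r • -d, fun i => ?_, ?_⟩
    · rw [map_add, map_smul]
      exact add_nonneg (he i) (mul_nonneg hr.le (hrec i))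
    · simp only at hze ⊢
      rw [← add_assoc, hze]
      module
  by_cases h1 : ∃ j, a j d < 0
  · by_cases h2 : ∃ j, a j (-d) < 0
    · obtain ⟨r, hr, hmem, hlt⟩ := exists_boundary_point hy hd h1
      obtain ⟨r', hr', hmem', hlt'⟩ := exists_boundary_point (d := -d) hy
        (fun i hi => by rw [map_neg, hd i hi, neg_zero]) h2
      have := hconv (ih _ hlt hmem rfl) (ih _ hlt' hmem' rfl)
        (a := r' / (r + r')) (b := r / (r + r')) (by positivity) (by positivity)
        (by field_simp; ring)
      convert this using 1
      have e1 : y = (r' / (r + r') + r / (r + r')) • y := by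
        rw [← add_div, add_comm r' r, div_self (by positivity), one_smul]
      have e2 : r' / (r + r') * r = r / (r + r') * r' := by ring
      rw [smul_add, smul_add, smul_smul, smul_smul, e2, smul_neg]
      nth_rw 1 [e1]
      module
    · push Not at h2
      exact half d hd h1 h2
  · push Not at h1
    by_cases h2 : ∃ j, a j (-d) < 0
    · exact half (-d) (fun i hi => by rw [map_neg, hd i hi, neg_zero]) h2 (by simpa using h1)
    · push Not at h2
      refine absurd (hline d fun i => le_antisymm ?_ (h1 i)) hd0
      have := h2 i
      rw [map_neg] at this
      linarith

end Polyhedra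

/-! ### Coordinates, coefficient forms of the inequalities, and cones with interior -/

section Coordinates

variable {k : ℕ}

@[simp] theorem append_castSucc (s : Fin k → ℝ) (r : ℝ) (i : Fin k) :
    append s r i.castSucc = s i := by simp [append]

@[simp] theorem append_last (s : Fin k → ℝ) (r : ℝ) : append s r (Fin.last k) = r := by
  simp [append]

@[simp] theorem head_append (s : Fin k → ℝ) (r : ℝ) : head (append s r) = s := by
  ext i; simp [head]

theorem vec_ext {y z : Vec k} (h : head y = head z) (hl : y (Fin.last k) = z (Fin.last k)) :
    y = z := by
  ext i
  refine Fin.lastCases hl (fun i => ?_) i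
  exact congrFun h i

@[simp] theorem head_add (y z : Vec k) : head (y + z) = head y + head z := rfl

@[simp] theorem head_sub (y z : Vec k) : head (y - z) = head y - head z := rfl

@[simp] theorem head_smul (r : ℝ) (y : Vec k) : head (r • y) = r • head y := rfl

@[simp] theorem head_neg (y : Vec k) : head (-y) = -head y := rfl

@[simp] theorem head_eLast : head (eLast k) = 0 := head_append _ _

@[simp] theorem eLast_last : eLast k (Fin.last k) = 1 := append_last _ _

theorem dotProduct_eq_head_add_last (y z : Vec k) :
    y ⬝ᵥ z = head y ⬝ᵥ head z + y (Fin.last k) * z (Fin.last k) := by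
  simp [dotProduct, Fin.sum_univ_castSucc, head]

@[simp] theorem head_omega (c : Vec k) (s : Fin k → ℝ) : head (omega c s) = s := head_append _ _

theorem omega_last (c : Vec k) (s : Fin k → ℝ) :
    omega c s (Fin.last k) = 1 - head c ⬝ᵥ s := append_last _ _

theorem dotProduct_omega {c : Vec k} (hcq : c (Fin.last k) = 1) (s : Fin k → ℝ) :
    c ⬝ᵥ omega c s = 1 := by
  rw [dotProduct_eq_head_add_last, head_omega, omega_last, hcq]
  ring

theorem omega_head {c : Vec k} (hcq : c (Fin.last k) = 1) {w : Vec k} (hw : c ⬝ᵥ w = 1) :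
    omega c (head w) = w := by
  refine vec_ext (head_omega _ _) ?_
  rw [dotProduct_eq_head_add_last, hcq] at hw
  rw [omega_last]
  linarith

theorem phi_eq (c y ys : Vec k) :
    phi c y ys = omega c (head ys) ⬝ᵥ y - ys (Fin.last k) := by
  rw [dotProduct_comm, dotProduct_eq_head_add_last, head_omega, omega_last]
  rfl

theorem mem_solutionSet_phiIneq (c y ys : Vec k) :
    (phiIneq c y).2 ≤ (phiIneq c y).1 ⬝ᵥ ys ↔ ys (Fin.last k) ≤ omega c (head ys) ⬝ᵥ y := by
  rw [phiIneq_iff, phi_eq, sub_nonneg]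

/-- The vector on the right is the linear part of `omega c` in direction `d`. It is orthogonal to
`c` when `c_q = 1`, which is what determines the recession cones. -/
theorem omegaIneq_dotProduct (c y d : Vec k) :
    (omegaIneq c y).1 ⬝ᵥ d = append (head d) (-(head c ⬝ᵥ head d)) ⬝ᵥ y := by
  rw [dotProduct_eq_head_add_last, dotProduct_eq_head_add_last (append _ _)]
  simp only [omegaIneq, head_append, append_last, dotProduct, sub_mul, Finset.sum_sub_distrib,
    zero_mul, add_zero, neg_mul, Finset.sum_mul]
  rw [sub_eq_add_neg]
  congr 1
  · exact Finset.sum_congr rfl fun i _ => mul_comm _ _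
  · congr 1
    exact Finset.sum_congr rfl fun i _ => by simp only [head]; ring

theorem phiIneq_dotProduct (c y d : Vec k) :
    (phiIneq c y).1 ⬝ᵥ d =
      append (head d) (-(head c ⬝ᵥ head d)) ⬝ᵥ y - d (Fin.last k) := by
  rw [← omegaIneq_dotProduct, dotProduct_eq_head_add_last, dotProduct_eq_head_add_last]
  simp only [omegaIneq, phiIneq, head_append, append_last]
  ring

theorem mem_hull_neg_eLast {d : Vec k} :
    d ∈ (PointedCone.hull ℝ ((({-eLast k} : Finset (Vec k)) : Set (Vec k))) : Set (Vec k)) ↔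
      ∃ r : ℝ, 0 ≤ r ∧ d = r • -eLast k := by
  rw [Finset.coe_singleton, SetLike.mem_coe, PointedCone.hull, Submodule.mem_span_singleton]
  constructor
  · rintro ⟨⟨r, hr⟩, rfl⟩
    exact ⟨r, hr, rfl⟩
  · rintro ⟨r, hr, rfl⟩
    exact ⟨⟨r, hr⟩, rfl⟩

/-- The solution set of a finite system is a polyhedron. -/
theorem solutionSet_eq_polyhedron (L : List (AffIneq k)) :
    solutionSet L = polyhedron (fun i : Fin L.length => dotProductBilin ℝ ℝ (L.get i).1)
      (fun i => (L.get i).2) := by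
  ext y
  exact List.forall_mem_iff_get

theorem extremePoints_solutionSet_finite (L : List (AffIneq k)) :
    ((solutionSet L).extremePoints ℝ).Finite := by
  rw [solutionSet_eq_polyhedron]
  exact extremePoints_polyhedron_finite _ _

theorem solutionSet_subset_conv_add (L : List (AffIneq k))
    (hline : ∀ d, (∀ h ∈ L, h.1 ⬝ᵥ d = 0) → d = 0) :
    solutionSet L ⊆ convexHull ℝ ((solutionSet L).extremePoints ℝ) +
      {d | ∀ h ∈ L, 0 ≤ h.1 ⬝ᵥ d} := by
  intro y hy
  have hset : {d : Vec k | ∀ h ∈ L, 0 ≤ h.1 ⬝ᵥ d} =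
      {d | ∀ i : Fin L.length, 0 ≤ dotProductBilin ℝ ℝ (L.get i).1 d} := by
    ext d
    exact List.forall_mem_iff_get
  rw [hset]
  rw [solutionSet_eq_polyhedron] at hy ⊢
  refine exists_add_of_mem_polyhedron (fun d hd => hline d ?_) hy
  exact List.forall_mem_iff_get.mpr hd

/-- A nonnegative functional on `C` that vanishes at an interior point of `C` is zero. -/
theorem eq_zero_of_dotProduct_interior {C : Set (Vec k)} {c v : Vec k} (hc : c ∈ interior C)
    (hv : ∀ y ∈ C, 0 ≤ v ⬝ᵥ y) (hvc : v ⬝ᵥ c = 0) : v = 0 := by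
  -- For small `ε > 0` the point `c - ε • v` is still in `C`, where `v` takes the value `-ε * (v ⬝ᵥ
  -- v)`.
  have hcont : Filter.Tendsto (fun ε : ℝ => c - ε • v) (nhds 0) (nhds c) := by
    have : Continuous fun ε : ℝ => c - ε • v := by fun_prop
    simpa using this.tendsto 0
  have hev : ∀ᶠ ε : ℝ in nhdsWithin 0 (Set.Ioi 0), c - ε • v ∈ C :=
    nhdsWithin_le_nhds (hcont.eventually (mem_interior_iff_mem_nhds.mp hc))
  obtain ⟨ε, hε, hpos⟩ := (hev.and self_mem_nhdsWithin).exists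
  have h := hv _ hε
  rw [dotProduct_sub, hvc, dotProduct_smul, smul_eq_mul, zero_sub] at h
  have h0 : 0 ≤ v ⬝ᵥ v := Finset.sum_nonneg fun i _ => mul_self_nonneg _
  refine dotProduct_self_eq_zero.mp (le_antisymm ?_ h0)
  by_contra! hlt
  have := mul_pos (show 0 < ε from hpos) hlt
  linarith

end Coordinates

/-! ### Solvability of the scalarizations and inequalities for the lower image -/

section Duality

variable {k m n o p : ℕ}

/-- The standing assumptions on the data and the ordering cone. -/
structure Data.Regular (I : Data k m n o p) (C : Set (Vec k)) : Prop where
  nonempty : I.S.Nonempty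
  cone_eq_generated : C = {y | ∃ l : Fin o → ℝ, 0 ≤ l ∧ y = I.Y *ᵥ l}
  cone_eq_dual : C = {y | 0 ≤ I.Zᵀ *ᵥ y}
  pointed : C ∩ -C = {0}
  mem_interior : I.c ∈ interior C
  last_eq_one : I.c (Fin.last k) = 1
  recc_subset : recc I.imageS ⊆ C

/-- The `j`-th column of `Y`. -/
def Data.colY (I : Data k m n o p) (j : Fin o) : Vec k := fun i => I.Y i j

/-- The lower image described by inequalities. -/
def Data.dualPolyhedron (I : Data k m n o p) : Set (Vec k) :=
  {ys | (∀ j, 0 ≤ I.colY j ⬝ᵥ omega I.c (head ys)) ∧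
    ∀ x ∈ I.S, ys (Fin.last k) ≤ omega I.c (head ys) ⬝ᵥ (I.P *ᵥ x)}

variable {I : Data k m n o p} {C : Set (Vec k)}

namespace Data.Regular

theorem dotProduct_nonneg_iff (h : I.Regular C) {w : Vec k} :
    (∀ y ∈ C, 0 ≤ w ⬝ᵥ y) ↔ ∀ j, 0 ≤ I.colY j ⬝ᵥ w := by
  rw [h.cone_eq_generated]
  constructor
  · intro hw j
    rw [dotProduct_comm]
    refine hw _ ⟨Pi.single j 1, ?_, ?_⟩
    · exact Pi.single_nonneg.mpr zero_le_one
    · rw [Matrix.mulVec_single_one]; rfl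
  · rintro hw _ ⟨l, hl, rfl⟩
    rw [Matrix.dotProduct_mulVec]
    refine Finset.sum_nonneg fun j _ => mul_nonneg ?_ (hl j)
    have := hw j
    rwa [dotProduct_comm] at this

theorem sumZ_nonneg (h : I.Regular C) {y : Vec k} (hy : y ∈ C) : 0 ≤ I.sumZ ⬝ᵥ y := by
  rw [h.cone_eq_dual] at hy
  have : I.sumZ ⬝ᵥ y = ∑ j, (I.Zᵀ *ᵥ y) j := by
    simp only [sumZ, dotProduct, Matrix.mulVec, Matrix.transpose_apply, Finset.sum_mul]
    exact Finset.sum_comm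
  rw [this]
  exact Finset.sum_nonneg fun j _ => hy j

/-- If this sum of nonnegative terms vanished, then `Zᵀ c = 0` and `-c ∈ C`, so pointedness would
give `c = 0`, against `c_q = 1`. -/
theorem dotProduct_sumZ_pos (h : I.Regular C) : 0 < I.c ⬝ᵥ I.sumZ := by
  have hcC := interior_subset h.mem_interior
  have hnn := h.sumZ_nonneg hcC
  rw [dotProduct_comm] at hnn
  refine lt_of_le_of_ne hnn fun h0 => ?_
  have hsum : I.c ⬝ᵥ I.sumZ = ∑ j, (I.Zᵀ *ᵥ I.c) j := by
    rw [dotProduct_comm]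
    simp only [sumZ, dotProduct, Matrix.mulVec, Matrix.transpose_apply, Finset.sum_mul]
    exact Finset.sum_comm
  have hcZ : 0 ≤ I.Zᵀ *ᵥ I.c := by
    have := hcC
    rwa [h.cone_eq_dual] at this
  have hzero : I.Zᵀ *ᵥ I.c = 0 := by
    ext j
    exact (Finset.sum_eq_zero_iff_of_nonneg fun j _ => hcZ j).mp (hsum.symm.trans h0.symm) j
      (Finset.mem_univ j)
  have hneg : -I.c ∈ C := by
    rw [h.cone_eq_dual]
    change 0 ≤ I.Zᵀ *ᵥ -I.c
    rw [Matrix.mulVec_neg, hzero, neg_zero]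
  have : I.c ∈ C ∩ -C := ⟨hcC, hneg⟩
  rw [h.pointed] at this
  have hc1 := h.last_eq_one
  rw [this] at hc1
  simp at hc1

/-- The initial weight is normalized. -/
theorem omega_init (h : I.Regular C) :
    omega I.c (head ((I.c ⬝ᵥ I.sumZ)⁻¹ • I.sumZ)) = (I.c ⬝ᵥ I.sumZ)⁻¹ • I.sumZ := by
  refine omega_head h.last_eq_one ?_
  rw [dotProduct_smul, smul_eq_mul, inv_mul_cancel₀ h.dotProduct_sumZ_pos.ne']

theorem omega_init_nonneg (h : I.Regular C) :
    ∀ y ∈ C, 0 ≤ omega I.c (head ((I.c ⬝ᵥ I.sumZ)⁻¹ • I.sumZ)) ⬝ᵥ y := by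
  intro y hy
  rw [h.omega_init, smul_dotProduct, smul_eq_mul]
  exact mul_nonneg (inv_nonneg.mpr h.dotProduct_sumZ_pos.le) (h.sumZ_nonneg hy)

theorem mulVec_mem_recc {d : Fin n → ℝ} (hd : 0 ≤ I.A *ᵥ d) : I.P *ᵥ d ∈ recc I.imageS := by
  rintro _ ⟨x, hx, rfl⟩ r hr
  refine ⟨x + r • d, ?_, ?_⟩
  · change I.b ≤ I.A *ᵥ (x + r • d)
    rw [Matrix.mulVec_add, Matrix.mulVec_smul]
    exact le_add_of_le_of_nonneg hx (smul_nonneg hr hd)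
  · simp only [Matrix.mulVec_add, Matrix.mulVec_smul]

/-- The objective is nonnegative on every `d` with `A d ≥ 0`, since `P d` is then a recession
direction of `P[S]`. Farkas' lemma yields multipliers `u`, and `bᵀ u` bounds the program below. -/
theorem exists_isSolution (h : I.Regular C) {w : Vec k} (hw : ∀ y ∈ C, 0 ≤ w ⬝ᵥ y) :
    ∃ x, I.IsSolution w x := by
  obtain ⟨u, hu, huf⟩ := farkas (Finset.univ : Finset (Fin m))
    (fun i => LinearMap.proj i ∘ₗ I.A.mulVecLin) (dotProductBilin ℝ ℝ w ∘ₗ I.P.mulVecLin)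
    fun d hd => hw _ (h.recc_subset (mulVec_mem_recc fun i => hd i (Finset.mem_univ i)))
  exact exists_isMinOn_of_bounded (fun i => LinearMap.proj i ∘ₗ I.A.mulVecLin) I.b (dotProductBilin ℝ ℝ w ∘ₗ I.P.mulVecLin)
    (∑ i, u i * I.b i) h.nonempty fun x hx => by
      rw [huf x]
      exact Finset.sum_le_sum fun i _ => mul_le_mul_of_nonneg_left (hx i) (hu i)

theorem weight_nonneg (h : I.Regular C) {ys : Vec k}
    (hys : ∀ j, 0 ≤ I.colY j ⬝ᵥ omega I.c (head ys)) :
    ∀ y ∈ C, 0 ≤ omega I.c (head ys) ⬝ᵥ y :=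
  h.dotProduct_nonneg_iff.mpr hys

/-- Weak duality gives one inclusion. For the other, affine Farkas turns the lower bound `y*_q` on
the scalarized program into a dual feasible `u` with `bᵀ u ≥ y*_q`; the excess is absorbed by `K`.
-/
theorem lowerImage_eq (h : I.Regular C) : I.lowerImage = I.dualPolyhedron := by
  ext ys
  constructor
  · rintro ⟨_, ⟨⟨u, w⟩, ⟨hu, hAu, hcw, hYw⟩, rfl⟩, _, ⟨r, hr, rfl⟩, rfl⟩
    simp only at hu hAu hcw hYw
    have hhead : omega I.c (head (I.dualObjective (u, w) - r • eLast k)) = w := by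
      simp [dualObjective, omega_head h.last_eq_one hcw]
    simp only [dualPolyhedron, Set.mem_ofPred_eq]
    rw [hhead]
    refine ⟨fun j => hYw j, fun x hx => ?_⟩
    rw [Matrix.dotProduct_mulVec, ← Matrix.mulVec_transpose, ← hAu, Matrix.mulVec_transpose,
      ← Matrix.dotProduct_mulVec]
    have h1 : I.b ⬝ᵥ u ≤ u ⬝ᵥ I.A *ᵥ x := by
      rw [dotProduct_comm]
      exact Finset.sum_le_sum fun i _ => mul_le_mul_of_nonneg_left (hx i) (hu i)
    simp only [dualObjective, Pi.sub_apply, Pi.smul_apply, append_last, eLast_last, smul_eq_mul]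
    linarith
  · rintro ⟨hY, hP⟩
    obtain ⟨u, hu, huf, hτ⟩ := farkas_affine (fun i => LinearMap.proj i ∘ₗ I.A.mulVecLin) I.b
      (dotProductBilin ℝ ℝ (omega I.c (head ys)) ∘ₗ I.P.mulVecLin) (ys (Fin.last k))
      h.nonempty hP
    refine ⟨I.dualObjective (u, omega I.c (head ys)),
      ⟨(u, omega I.c (head ys)), ⟨hu, ?_, dotProduct_omega h.last_eq_one _, hY⟩, rfl⟩,
      (I.b ⬝ᵥ u - ys (Fin.last k)) • eLast k, ⟨_, ?_, rfl⟩, ?_⟩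
    · simp only [Matrix.mulVec_transpose]
      refine dotProduct_eq _ _ fun x => ?_
      rw [← Matrix.dotProduct_mulVec, ← Matrix.dotProduct_mulVec]
      exact (huf x).symm
    · rw [dotProduct_comm, sub_nonneg]
      exact hτ
    · refine vec_ext ?_ ?_
      · simp [dualObjective]
      · simp [dualObjective]

/-- The initial weight with its optimal value as last coordinate is such a point. This guarantees
that the output contains a vertex. -/
theorem dualPolyhedron_nonempty (h : I.Regular C) : I.dualPolyhedron.Nonempty := by
  obtain ⟨x, -, hmin⟩ := h.exists_isSolution h.omega_init_nonneg
  set s := head ((I.c ⬝ᵥ I.sumZ)⁻¹ • I.sumZ)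
  refine ⟨append s (omega I.c s ⬝ᵥ (I.P *ᵥ x)), ?_, ?_⟩
  · rw [head_append]
    exact h.dotProduct_nonneg_iff.mp h.omega_init_nonneg
  · rw [head_append, append_last]
    exact hmin

end Data.Regular

theorem Data.convex_dualPolyhedron (I : Data k m n o p) : Convex ℝ I.dualPolyhedron := by
  have hhalf : ∀ h : AffIneq k, Convex ℝ {y : Vec k | h.2 ≤ h.1 ⬝ᵥ y} := fun h =>
    convex_halfSpace_ge (dotProductBilin ℝ ℝ h.1).isLinear _
  have : I.dualPolyhedron = (⋂ j, {y | (omegaIneq I.c (I.colY j)).2 ≤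
      (omegaIneq I.c (I.colY j)).1 ⬝ᵥ y}) ∩
      ⋂ x ∈ I.S, {y | (phiIneq I.c (I.P *ᵥ x)).2 ≤ (phiIneq I.c (I.P *ᵥ x)).1 ⬝ᵥ y} := by
    ext y
    simp [dualPolyhedron, omegaIneq_iff, mem_solutionSet_phiIneq]
  rw [this]
  exact (convex_iInter fun j => hhalf _).inter (convex_iInter₂ fun x _ => hhalf _)

theorem Data.add_smul_mem_dualPolyhedron {y : Vec k} (hy : y ∈ I.dualPolyhedron) {r : ℝ}
    (hr : 0 ≤ r) : y + r • -eLast k ∈ I.dualPolyhedron := by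
  simp only [dualPolyhedron, Set.mem_ofPred_eq, head_add, head_smul, head_neg, head_eLast,
    neg_zero, smul_zero, add_zero]
  refine ⟨hy.1, fun x hx => le_trans ?_ (hy.2 x hx)⟩
  simp [hr]

end Duality

/-! ### Invariants, correctness and termination of the algorithm -/

section Algorithm

variable {k m n o p : ℕ}

/-- The systems that the algorithm works with: the initial inequalities and cuts `φ(P x, ·) ≥ 0`
at feasible points `x`. -/
structure Data.IsCutSystem (I : Data k m n o p) (L : List (AffIneq k)) : Prop where
  omegaIneq_mem : ∀ j, omegaIneq I.c (I.colY j) ∈ L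
  eq_or_eq : ∀ h ∈ L, (∃ j, h = omegaIneq I.c (I.colY j)) ∨
    ∃ x ∈ I.S, h = phiIneq I.c (I.P *ᵥ x)

/-- The system contains at least one cut. -/
def Data.HasCut (I : Data k m n o p) (L : List (AffIneq k)) : Prop :=
  ∃ x, phiIneq I.c (I.P *ᵥ x) ∈ L

variable {I : Data k m n o p} {C : Set (Vec k)} {L : List (AffIneq k)}

namespace Data.IsCutSystem

theorem dualPolyhedron_subset (hL : I.IsCutSystem L) : I.dualPolyhedron ⊆ solutionSet L := by
  intro y hy h hh
  rcases hL.eq_or_eq h hh with ⟨j, rfl⟩ | ⟨x, hx, rfl⟩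
  · exact (omegaIneq_iff _ _ _).mpr (hy.1 j)
  · exact (mem_solutionSet_phiIneq _ _ _).mpr (hy.2 x hx)

theorem weight_mem (hL : I.IsCutSystem L) {y : Vec k} (hy : y ∈ solutionSet L) (j : Fin o) :
    0 ≤ I.colY j ⬝ᵥ omega I.c (head y) :=
  (omegaIneq_iff _ _ _).mp (hy _ (hL.omegaIneq_mem j))

theorem cons (hL : I.IsCutSystem L) {x : Fin n → ℝ} (hx : x ∈ I.S) :
    I.IsCutSystem (phiIneq I.c (I.P *ᵥ x) :: L) where
  omegaIneq_mem j := List.mem_cons_of_mem _ (hL.omegaIneq_mem j)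
  eq_or_eq h hh := by
    rcases List.mem_cons.mp hh with rfl | hh
    · exact Or.inr ⟨x, hx, rfl⟩
    · exact hL.eq_or_eq h hh

/-- Once a cut has been made, the recession cone of the outer approximation is generated
by `-e^q`. -/
theorem eq_smul_neg_eLast (hL : I.IsCutSystem L) (hI : I.Regular C) (hcut : I.HasCut L)
    {d : Vec k} (hd : ∀ h ∈ L, 0 ≤ h.1 ⬝ᵥ d) : ∃ r : ℝ, 0 ≤ r ∧ d = r • -eLast k := by
  -- The initial inequalities make this vector nonnegative on `C`, and it vanishes at the interior
  -- point `c`.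
  have hv : append (head d) (-(head I.c ⬝ᵥ head d)) = 0 := by
    refine eq_zero_of_dotProduct_interior hI.mem_interior
      (hI.dotProduct_nonneg_iff.mpr fun j => ?_) ?_
    · rw [dotProduct_comm, ← omegaIneq_dotProduct]
      exact hd _ (hL.omegaIneq_mem j)
    · rw [dotProduct_eq_head_add_last, head_append, append_last, hI.last_eq_one, mul_one,
        dotProduct_comm, add_neg_cancel]
  have hhead : head d = 0 := by
    have := congrArg head hv
    rwa [head_append] at this
  obtain ⟨x, hx⟩ := hcut
  -- With `head d = 0`, a cut reads `-d_q ≥ 0`; the initial inequalities alone leave `d_q` free.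
  have hlast := hd _ hx
  rw [phiIneq_dotProduct, hv, zero_dotProduct, zero_sub] at hlast
  refine ⟨-d (Fin.last k), hlast, vec_ext ?_ ?_⟩
  · simp [hhead]
  · simp

theorem eq_zero_of_dotProduct_eq_zero (hL : I.IsCutSystem L) (hI : I.Regular C)
    (hcut : I.HasCut L) {d : Vec k} (hd : ∀ h ∈ L, h.1 ⬝ᵥ d = 0) : d = 0 := by
  obtain ⟨r, hr, hdr⟩ := hL.eq_smul_neg_eLast hI hcut fun h hh => (hd h hh).ge
  obtain ⟨r', hr', hdr'⟩ := hL.eq_smul_neg_eLast hI hcut (d := -d) fun h hh => by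
    rw [dotProduct_neg, hd h hh, neg_zero]
  have h1 := congrFun hdr (Fin.last k)
  have h2 := congrFun hdr' (Fin.last k)
  simp at h1 h2
  have : r = 0 := by linarith
  rw [hdr, this, zero_smul]

/-- If all vertices of the outer approximation lie in the lower image, then they represent it. -/
theorem representations (hL : I.IsCutSystem L) (hI : I.Regular C) (hcut : I.HasCut L)
    {poi : Finset (Vec k)} (hpoi : (poi : Set (Vec k)) = (solutionSet L).extremePoints ℝ)
    (hsub : ∀ y ∈ poi, y ∈ I.dualPolyhedron) :
    IsHRep L I.lowerImage ∧ IsVRep poi {-eLast k} I.lowerImage := by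
  have hconv : convexHull ℝ (poi : Set (Vec k)) ⊆ I.dualPolyhedron :=
    convexHull_min hsub I.convex_dualPolyhedron
  have h1 : solutionSet L ⊆ convexHull ℝ (poi : Set (Vec k)) +
      (PointedCone.hull ℝ (({-eLast k} : Finset (Vec k)) : Set (Vec k)) : Set (Vec k)) := by
    rw [hpoi]
    refine (solutionSet_subset_conv_add L fun d hd =>
      hL.eq_zero_of_dotProduct_eq_zero hI hcut hd).trans (Set.add_subset_add_left ?_)
    intro d hd
    exact mem_hull_neg_eLast.mpr (hL.eq_smul_neg_eLast hI hcut hd)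
  have h2 : convexHull ℝ (poi : Set (Vec k)) +
      (PointedCone.hull ℝ (({-eLast k} : Finset (Vec k)) : Set (Vec k)) : Set (Vec k)) ⊆
      I.dualPolyhedron := by
    rintro _ ⟨z, hz, d, hd, rfl⟩
    obtain ⟨r, hr, rfl⟩ := mem_hull_neg_eLast.mp hd
    exact I.add_smul_mem_dualPolyhedron (hconv hz) hr
  have h3 := hL.dualPolyhedron_subset
  rw [hI.lowerImage_eq]
  refine ⟨h3.antisymm (h1.trans h2), ?_, (h3.trans h1).antisymm h2⟩
  obtain ⟨y, hy⟩ := hI.dualPolyhedron_nonempty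
  obtain ⟨z, hz, -⟩ := h1 (h3 hy)
  exact Finset.coe_nonempty.mp (convexHull_nonempty_iff.mp ⟨z, hz⟩)

end Data.IsCutSystem

/-- The part of the loop invariant that holds after the first pass. -/
structure Data.Cut (I : Data k m n o p) (v : Vars k) : Prop where
  hasCut : I.HasCut v.ineqs
  poi_eq : (v.poi : Set (Vec k)) = (solutionSet v.ineqs).extremePoints ℝ
  exists_eq : ∃ t ∈ v.poi \ v.confirmed, v.t = toExt t

/-- The loop invariant. -/
structure Data.Inv (I : Data k m n o p) (C : Set (Vec k)) (v : Vars k) : Prop where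
  system : I.IsCutSystem v.ineqs
  confirmed_mem : ∀ y ∈ v.confirmed, y ∈ I.dualPolyhedron
  weight_nonneg : ∀ y ∈ C, 0 ≤ omega I.c v.t.1 ⬝ᵥ y
  cut : v.t.2 = ⊤ ∨ I.Cut v

/-- The invariant of all states. -/
def Data.StateInv (I : Data k m n o p) (C : Set (Vec k)) : State k → Prop
  | .running v => I.Inv C v
  | .halted L poi => I.IsCutSystem L ∧ I.HasCut L ∧
      (poi : Set (Vec k)) = (solutionSet L).extremePoints ℝ ∧ ∀ y ∈ poi, y ∈ I.dualPolyhedron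

/-- The failed test at a vertex bounds its last coordinate by the optimal value, hence by the value
at every feasible point, so the vertex satisfies all inequalities of the lower image. With `t*_q =
∞` the test cannot fail, so the first pass makes a cut. -/
theorem Data.Inv.update {v : Vars k} (hv : I.Inv C v) {x : Fin n → ℝ}
    (hx : I.IsSolution (omega I.c v.t.1) x) {poi T : Finset (Vec k)}
    (hu : I.Update v x L poi T) :
    I.IsCutSystem L ∧ I.HasCut L ∧ (poi : Set (Vec k)) = (solutionSet L).extremePoints ℝ ∧
      ∀ y ∈ T, y ∈ I.dualPolyhedron := by
  cases hu with
  | cut _ htest hpoi =>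
    exact ⟨hv.system.cons hx.1, ⟨x, List.mem_cons_self⟩, hpoi, hv.confirmed_mem⟩
  | confirm y hy htest =>
    rcases hv.cut with h | h
    · rw [hy] at h
      exact absurd h (WithTop.coe_ne_top)
    · refine ⟨hv.system, h.hasCut, h.poi_eq, fun z hz => ?_⟩
      rcases Finset.mem_insert.mp hz with rfl | hz
      · obtain ⟨t, ht, hvt⟩ := h.exists_eq
        have hzt : z = t := by
          rw [hvt] at hy
          exact vec_ext (congrArg Prod.fst hy).symm
            (WithTop.coe_injective (congrArg Prod.snd hy).symm)
        have hzsol : z ∈ solutionSet v.ineqs := by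
          rw [hzt]
          have : t ∈ (v.poi : Set (Vec k)) := (Finset.mem_sdiff.mp ht).1
          rw [h.poi_eq] at this
          exact this.1
        refine ⟨hv.system.weight_mem hzsol, fun x' hx' => ?_⟩
        rw [hy] at htest
        have hle : z (Fin.last k) ≤ omega I.c (head z) ⬝ᵥ (I.P *ᵥ x) :=
          WithTop.coe_le_coe.mp (not_lt.mp htest)
        have hmin := hx.2 x' hx'
        rw [hy] at hmin
        exact hle.trans hmin
      · exact hv.confirmed_mem z hz

namespace Data.Regular

theorem stateInv_init (hI : I.Regular C) : I.StateInv C I.init where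
  system :=
    { omegaIneq_mem := fun j => List.mem_ofFn.mpr ⟨j, rfl⟩
      eq_or_eq := fun h hh => by
        obtain ⟨j, rfl⟩ := List.mem_ofFn.mp hh
        exact Or.inl ⟨j, rfl⟩ }
  confirmed_mem := fun y hy => absurd hy (Finset.notMem_empty y)
  weight_nonneg := hI.omega_init_nonneg
  cut := Or.inl rfl

theorem stateInv_step (hI : I.Regular C) {s s' : State k} (hs : I.StateInv C s)
    (hstep : I.Step s s') : I.StateInv C s' := by
  rcases hstep with ⟨v, x, hx, L, poi, T, hu, t, ht⟩ | ⟨v, x, hx, L, poi, T, hu, hT⟩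
  · obtain ⟨hL, hcut, hpoi, hT⟩ := Data.Inv.update hs hx hu
    have htsol : t ∈ (poi : Set (Vec k)) := (Finset.mem_sdiff.mp ht).1
    rw [hpoi] at htsol
    exact ⟨hL, hT, hI.weight_nonneg (hL.weight_mem htsol.1),
      Or.inr ⟨hcut, hpoi, t, ht, rfl⟩⟩
  · obtain ⟨hL, hcut, hpoi, hTm⟩ := Data.Inv.update hs hx hu
    exact ⟨hL, hcut, hpoi, fun y hy => hTm y (Finset.sdiff_eq_empty_iff_subset.mp hT hy)⟩

theorem stateInv_of_reachable (hI : I.Regular C) {s : State k} (hs : I.Reachable s) :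
    I.StateInv C s := by
  induction hs with
  | refl => exact hI.stateInv_init
  | tail _ hstep ih => exact hI.stateInv_step ih hstep

end Data.Regular

theorem Data.Inv.exists_update {v : Vars k} (hv : I.Inv C v) (x : Fin n → ℝ) :
    ∃ L poi T, I.Update v x L poi T := by
  by_cases htest : ((omega I.c v.t.1 ⬝ᵥ (I.P *ᵥ x) : ℝ) : WithTop ℝ) < v.t.2
  · exact ⟨_, _, _, .cut (extremePoints_solutionSet_finite _).toFinset htest
      (Set.Finite.coe_toFinset _)⟩
  · rcases hv.cut with h | h
    · rw [h] at htest
      exact absurd (WithTop.coe_lt_top _) htest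
    · obtain ⟨t, -, ht⟩ := h.exists_eq
      exact ⟨_, _, _, .confirm t ht htest⟩

/-- The constraints that are active at `x`. -/
def Data.active (I : Data k m n o p) (x : Fin n → ℝ) : Set (Fin m) :=
  {i | (I.A *ᵥ x) i = I.b i}

/-- The sets of constraints that are not the active set of a feasible point at which `L`
has a cut. -/
def Data.unusedActive (I : Data k m n o p) (L : List (AffIneq k)) : Set (Set (Fin m)) :=
  {J | ∀ x ∈ I.S, phiIneq I.c (I.P *ᵥ x) ∈ L → I.active x ≠ J}

/-- The termination measure. -/
noncomputable def Data.stateMeasure (I : Data k m n o p) : State k → ℕ × ℕ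
  | .running v => ((I.unusedActive v.ineqs).ncard, (v.poi \ v.confirmed).card)
  | .halted _ _ => (0, 0)

/-- A feasible point whose active constraints are those of an optimal solution
is optimal as well. -/
theorem Data.IsSolution.le_of_active_eq {w : Vec k} {x x₁ : Fin n → ℝ}
    (hx : I.IsSolution w x) (hact : I.active x₁ = I.active x) :
    w ⬝ᵥ (I.P *ᵥ x₁) ≤ w ⬝ᵥ (I.P *ᵥ x) := by
  -- Equal active sets allow a small step from `x` directly away from `x₁`; optimality of `x`
  -- forbids that step to decrease the objective.
  have hev := eventually_add_smul_mem_polyhedron (d := x - x₁)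
    (a := fun i => LinearMap.proj i ∘ₗ I.A.mulVecLin) (β := I.b) hx.1 (by
      intro i hi
      have h1 : i ∈ I.active x := hi
      rw [← hact] at h1
      rw [map_sub, hi]
      exact (sub_eq_zero.mpr (show (I.A *ᵥ x₁) i = I.b i from h1).symm).ge)
  obtain ⟨ε, hmem, hε⟩ := (hev.and self_mem_nhdsWithin).exists
  have h := hx.2 _ hmem
  rw [Matrix.mulVec_add, Matrix.mulVec_smul, Matrix.mulVec_sub, dotProduct_add, dotProduct_smul,
    dotProduct_sub, smul_eq_mul, le_add_iff_nonneg_right] at h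
  linarith [nonneg_of_mul_nonneg_right h (show 0 < ε from hε)]

/-- A cut uses a new active set: an old cut at `x₁` with the active set of `x` would give `t_q ≤ wᵀ
P x₁ ≤ wᵀ P x < t_q`. The vertex list may then grow, whence the lexicographic order. Without a cut,
the first component is unchanged and `t` leaves the unconfirmed vertices. -/
theorem Data.Inv.stateMeasure_lt {v : Vars k} (hv : I.Inv C v) (hfin : v.t.2 ≠ ⊤) {v' : Vars k}
    (hstep : I.Step (.running v) (.running v')) :
    Prod.Lex (· < ·) (· < ·) (I.stateMeasure (.running v')) (I.stateMeasure (.running v)) := by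
  obtain ⟨hcut, hpoi, t, ht, hvt⟩ := hv.cut.resolve_left hfin
  cases hstep with
  | next _ x hx L poi T hu t' ht' =>
  cases hu with
  | cut _ htest hpoi' =>
    refine Prod.Lex.left _ _ (Set.ncard_lt_ncard ⟨fun J hJ y hy hmem => ?_, fun hsub => ?_⟩
      (Set.toFinite _))
    · exact hJ y hy (List.mem_cons_of_mem _ hmem)
    · refine hsub (a := I.active x) (fun x₁ hx₁ hmem hact => ?_) x hx.1 List.mem_cons_self rfl
      have hle := hx.le_of_active_eq hact
      have htsol : t ∈ (v.poi : Set (Vec k)) := (Finset.mem_sdiff.mp ht).1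
      rw [hpoi] at htsol
      have h1 := (mem_solutionSet_phiIneq _ _ _).mp (htsol.1 _ hmem)
      rw [hvt] at htest hle
      have h2 : omega I.c (head t) ⬝ᵥ (I.P *ᵥ x) < t (Fin.last k) := WithTop.coe_lt_coe.mp htest
      exact absurd (h1.trans hle) (not_le.mpr h2)
  | confirm y hy htest =>
    refine Prod.Lex.right _ (Finset.card_lt_card ?_)
    have hyt : y = t := by
      rw [hvt] at hy
      exact vec_ext (congrArg Prod.fst hy).symm
        (WithTop.coe_injective (congrArg Prod.snd hy).symm)
    subst hyt
    refine ⟨Finset.sdiff_subset_sdiff (Finset.Subset.refl _) (Finset.subset_insert _ _),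
      fun hsub => ?_⟩
    have := hsub ht
    simp at this

theorem Data.Step.exists_running {s s' s'' : State k} (h : I.Step s s') (h' : I.Step s' s'') :
    ∃ v, s' = .running v ∧ v.t.2 ≠ ⊤ := by
  rcases h with ⟨v, x, hx, L, poi, T, hu, t, ht⟩ | ⟨v, x, hx, L, poi, T, hu, hT⟩
  · exact ⟨_, rfl, WithTop.coe_ne_top⟩
  · cases h'

theorem Data.Regular.not_exists_infinite_run (hI : I.Regular C) :
    ¬ ∃ s : ℕ → State k, s 0 = I.init ∧ ∀ i, I.Step (s i) (s (i + 1)) := by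
  rintro ⟨s, h0, hstep⟩
  have hinv : ∀ i, I.StateInv C (s i) := by
    intro i
    induction i with
    | zero => rw [h0]; exact hI.stateInv_init
    | succ i ih => exact hI.stateInv_step ih (hstep i)
  have hrun := fun i => Data.Step.exists_running (hstep i) (hstep (i + 1))
  -- The index is shifted by one because the decrease needs a finite `t*_q`, which fails in the
  -- initial state.
  obtain ⟨i, hi⟩ := WellFounded.not_rel_apply_succ (r := Prod.Lex (· < ·) (· < ·))
    fun i => I.stateMeasure (s (i + 1))
  obtain ⟨v, hv, hvt⟩ := hrun i
  obtain ⟨v', hv', -⟩ := hrun (i + 1)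
  have hinv' := hinv (i + 1)
  have hst := hstep (i + 1)
  rw [hv] at hinv' hst
  rw [hv'] at hst
  refine hi ?_
  simp only [hv, hv']
  exact Data.Inv.stateMeasure_lt hinv' hvt hst

end Algorithm

end DualBenson

theorem mainTheorem7 (k m n o p : ℕ) (I : DualBenson.Data k m n o p)
    (C : Set (DualBenson.Vec k))
    (hS : I.S.Nonempty)
    (hCY : C = {y | ∃ l : Fin o → ℝ, 0 ≤ l ∧ y = I.Y *ᵥ l})
    (hCZ : C = {y | 0 ≤ I.Zᵀ *ᵥ y})
    (hpointed : C ∩ -C = {0})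
    (hc : I.c ∈ interior C)
    (hcq : I.c (Fin.last k) = 1)
    (hB : DualBenson.recc I.imageS ⊆ C) :
    -- the initialization is well defined
    I.c ⬝ᵥ I.sumZ ≠ 0 ∧
    -- every linear program that is passed to the solver has an optimal solution
    (∀ v : DualBenson.Vars k, I.Reachable (.running v) →
      ∃ x, I.IsSolution (DualBenson.omega I.c v.t.1) x) ∧
    -- whatever the solver returns, the pass through the loop body can be completed
    (∀ v : DualBenson.Vars k, I.Reachable (.running v) →
      ∀ x, I.IsSolution (DualBenson.omega I.c v.t.1) x →
        ∃ L poi T, I.Update v x L poi T ∧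
          ((poi \ T = ∅ ∧ I.Step (.running v) (.halted L poi)) ∨
            ∃ t ∈ poi \ T, I.Step (.running v) (.running ⟨L, poi, T, DualBenson.toExt t⟩))) ∧
    -- finiteness: there is no infinite execution
    (¬ ∃ s : ℕ → DualBenson.State k, s 0 = I.init ∧ ∀ i, I.Step (s i) (s (i + 1))) ∧
    -- correctness: the output represents the lower image
    (∀ (L : List (DualBenson.AffIneq k)) (poi : Finset (DualBenson.Vec k)),
      I.Reachable (.halted L poi) →
        DualBenson.IsHRep L I.lowerImage ∧
        DualBenson.IsVRep poi {-DualBenson.eLast k} I.lowerImage) := by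
  have hI : I.Regular C := ⟨hS, hCY, hCZ, hpointed, hc, hcq, hB⟩
  have hinv : ∀ v : DualBenson.Vars k, I.Reachable (.running v) → I.Inv C v :=
    fun v hv => hI.stateInv_of_reachable hv
  refine ⟨hI.dotProduct_sumZ_pos.ne', fun v hv => hI.exists_isSolution (hinv v hv).weight_nonneg,
    fun v hv x hx => ?_, hI.not_exists_infinite_run, fun L poi hhalt => ?_⟩
  · obtain ⟨L, poi, T, hu⟩ := (hinv v hv).exists_update x
    refine ⟨L, poi, T, hu, ?_⟩
    rcases (poi \ T).eq_empty_or_nonempty with hT | ⟨t, ht⟩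
    · exact Or.inl ⟨hT, .break v x hx L poi T hu hT⟩
    · exact Or.inr ⟨t, ht, .next v x hx L poi T hu t ht⟩
  · obtain ⟨hL, hcut, hpoi, hsub⟩ := hI.stateInv_of_reachable hhalt
    exact hL.representations hI hcut hpoi hsub
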